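/- Let $\Gamma$ be a torsion-free hyperbolic group, and let $G$ be a $\Gamma$-limit group, i.e. a finitely generated group such that for every finite set $S \subseteq G \setminus \{1\}$ there is a homomorphism $\phi : G \to \Gamma$ with $1 \notin \phi(S)$. For finite generating sets $X$ of $G$ and $Y$ of $\Gamma$, let $|\cdot|_X$ and $|\cdot|_Y$ denote the word lengths, and define the $\Gamma$-discriminating complexity of $G$ as the function $C : \mathbb{N} \to \mathbb{N}$ (where $0\in\mathbb{N}$), \[ C(R) = \min\Bigl\{ \max_{x \in X} |\phi(x)|_Y \;:\; \phi : G \to \Gamma \text{ a homomorphism with } \phi(g) \neq 1 \text{ for all } g \in G\setminus\{1\} \text{ with } |g|_X \leq R \Bigr\}. \] Let $n \geq 0$ be an integer, and suppose that $G$ contains a free abelian subgroup of rank $n+1$. Then, for all finite generating sets $X$ of $G$ and $Y$ of $\Gamma$, the function $C$ asymptotically dominates a polynomial of degree $n$: there are a polynomial $p$ of degree $n$ with coefficients in $\mathbb{N}$ and a constant $K \in \mathbb{N}$ such that \[ p(R) \leq K \, C(KR) + K \qquad \text{for all } R \in \mathbb{N}. \] -/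

import Mathlib

namespace LimitGroups

/-- The word length of `g` with respect to `X`: the least number of letters in a word
with letters in `X ∪ X⁻¹` that represents `g`, that is, the least number of edges in a path
from `1` to `g` in the Cayley graph. (Used only for generating sets `X`, where such words exist.) -/
noncomputable def wordLength {G : Type*} [Group G] (X : Set G) (g : G) : ℕ :=
  sInf {k : ℕ | ∃ l : List G, (∀ x ∈ l, x ∈ X ∨ x⁻¹ ∈ X) ∧ l.prod = g ∧ l.length = k}

/-- The word metric, i.e. the path metric on the vertices of the Cayley graph, whose edges join
`g` to `g * x` for `x ∈ X`. -/
noncomputable def wordDist {G : Type*} [Group G] (X : Set G) (g h : G) : ℕ :=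
  wordLength X (g⁻¹ * h)

/-- The closed ball of radius `R` about `1`. -/
def ball {G : Type*} [Group G] (X : Set G) (R : ℕ) : Set G :=
  {g : G | wordLength X g ≤ R}

/-- `X` is a finite generating set of the group `G`. -/
def IsFiniteGeneratingSet {G : Type*} [Group G] (X : Finset G) : Prop :=
  Subgroup.closure (X : Set G) = ⊤

/-- The restriction of `p` to `{0, …, L}` is the sequence of vertices of a geodesic of length `L`
from `a` to `b` in the Cayley graph. -/
def IsGeodesic {G : Type*} [Group G] (X : Set G) (a b : G) (L : ℕ) (p : ℕ → G) : Prop :=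
  p 0 = a ∧ p L = b ∧ ∀ i j : ℕ, i ≤ j → j ≤ L → wordDist X (p i) (p j) = j - i

/-- Thin triangles: each vertex of a side of a geodesic triangle in the Cayley graph is `δ`-close
to a vertex of one of the two other sides. As the triangle is arbitrary and geodesics can be
reversed, it suffices to say this for one of the sides. -/
def HasThinTriangles {G : Type*} [Group G] (X : Set G) (δ : ℕ) : Prop :=
  ∀ (a b c : G) (L M N : ℕ) (p q r : ℕ → G),
    IsGeodesic X a b L p → IsGeodesic X b c M q → IsGeodesic X a c N r →
    ∀ i ≤ L, (∃ j ≤ M, wordDist X (p i) (q j) ≤ δ) ∨ (∃ j ≤ N, wordDist X (p i) (r j) ≤ δ)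

/-- A (word-)hyperbolic group: a group with a finite generating set whose Cayley graph is
`δ`-hyperbolic for some `δ`. -/
def IsHyperbolicGroup (G : Type*) [Group G] : Prop :=
  ∃ X : Finset G, IsFiniteGeneratingSet X ∧ ∃ δ : ℕ, HasThinTriangles (X : Set G) δ

/-- No nontrivial element has finite order. -/
def IsTorsionFreeGroup (G : Type*) [Group G] : Prop :=
  ∀ g : G, g ≠ 1 → ¬ IsOfFinOrder g

/-- The homomorphism `φ` discriminates `S`: no element of `S` is mapped to `1`. -/
def Discriminates {G H : Type*} [Group G] [Group H] (φ : G →* H) (S : Set G) : Prop :=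
  ∀ s ∈ S, φ s ≠ 1

/-- `G` is fully residually `H`. -/
def IsFullyResidually (G H : Type*) [Group G] [Group H] : Prop :=
  ∀ S : Set G, S.Finite → 1 ∉ S → ∃ φ : G →* H, Discriminates φ S

/-- `G` is a `Γ`-limit group: finitely generated and fully residually `Γ`. -/
def IsLimitGroup (Γ G : Type*) [Group Γ] [Group G] : Prop :=
  Group.FG G ∧ IsFullyResidually G Γ

/-- The complexity of a homomorphism: the maximal `Y`-length of the image of an element of `X`. -/
noncomputable def homComplexity {G H : Type*} [Group G] [Group H] (X : Finset G) (Y : Finset H)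
    (φ : G →* H) : ℕ :=
  X.sup fun x => wordLength (Y : Set H) (φ x)

/-- The `H`-discriminating complexity of `G` with respect to `X` and `Y`: the minimal complexity of
a homomorphism `G → H` that discriminates the nontrivial elements of the ball of radius `R`. -/
noncomputable def discriminatingComplexity {G H : Type*} [Group G] [Group H] (X : Finset G)
    (Y : Finset H) (R : ℕ) : ℕ :=
  sInf {k : ℕ | ∃ φ : G →* H, Discriminates φ (ball (X : Set G) R \ {1}) ∧
    homComplexity X Y φ = k}

/-- `f ≼ g`: `f` is asymptotically dominated by `g`. -/
def AsymptoticallyDominatedBy (f g : ℕ → ℕ) : Prop :=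
  ∃ K : ℕ, ∀ R : ℕ, f R ≤ K * g (K * R) + K

/-- `G` has a free Abelian subgroup of rank `m`. -/
def HasFreeAbelianSubgroupOfRank (G : Type*) [Group G] (m : ℕ) : Prop :=
  ∃ A : Subgroup G, Nonempty (A ≃* Multiplicative (Fin m → ℤ))

end LimitGroups

/-!
A commuting family of elements of small stable length in a hyperbolic group can be conjugated into
a ball whose radius depends only on the hyperbolicity constant: as long as the longest element of
the family is too long, conjugating by a short initial segment of it shortens every long element of
the family. On commuting elements the stable length `τ` satisfies
`τ (a * b) + τ (a * b⁻¹) ≤ 2 * max (τ a) (τ b)`, and applying this also to the pair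
`a * b`, `a * b⁻¹` gives `min (τ (a * b)) (τ (a * b⁻¹)) ≤ |τ a - τ b|`. Hence the elements of an
abelian subgroup whose stable lengths lie in a given interval of length `1` number at most twice
the size of that ball, so that abelian subgroups have linear growth, uniformly.

A copy of `ℤⁿ⁺¹` in `G` has about `Rⁿ⁺¹` elements of length `O(R)`. A homomorphism of complexity `C`
that discriminates a ball of radius `O(R)` is injective on them and maps them into the ball of
radius `O(C * R)` of an abelian subgroup, which has only `O(C * R)` elements. Hence `Rⁿ = O(C)`.
-/

namespace LimitGroups

section WordLength

variable {G : Type*} [Group G] {X : Set G}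

theorem wordLength_prod_le_length {l : List G} (hl : ∀ x ∈ l, x ∈ X ∨ x⁻¹ ∈ X) :
    wordLength X l.prod ≤ l.length :=
  Nat.sInf_le ⟨l, hl, rfl, rfl⟩

theorem exists_list_length_eq_wordLength (hX : Subgroup.closure X = ⊤) (g : G) :
    ∃ l : List G, (∀ x ∈ l, x ∈ X ∨ x⁻¹ ∈ X) ∧ l.prod = g ∧ l.length = wordLength X g := by
  have hg : g ∈ Submonoid.closure (X ∪ X⁻¹) := by
    rw [← Subgroup.closure_toSubmonoid, hX]
    trivial
  obtain ⟨l, hl, hlg⟩ := Submonoid.exists_list_of_mem_closure hg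
  exact Nat.sInf_mem (s := {k | ∃ l : List G, (∀ x ∈ l, x ∈ X ∨ x⁻¹ ∈ X) ∧ l.prod = g ∧
    l.length = k}) ⟨l.length, l, hl, hlg, rfl⟩

@[simp] theorem wordLength_one (X : Set G) : wordLength X 1 = 0 := by
  simpa using wordLength_prod_le_length (X := X) (l := []) (by simp)

theorem wordLength_le_one {x : G} (hx : x ∈ X ∨ x⁻¹ ∈ X) : wordLength X x ≤ 1 := by
  simpa using wordLength_prod_le_length (X := X) (l := [x]) (by simpa using hx)

@[simp] theorem wordLength_inv (X : Set G) (g : G) : wordLength X g⁻¹ = wordLength X g := by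
  have inv_word : ∀ (h : G) (k : ℕ),
      (∃ l : List G, (∀ x ∈ l, x ∈ X ∨ x⁻¹ ∈ X) ∧ l.prod = h ∧ l.length = k) →
      ∃ l : List G, (∀ x ∈ l, x ∈ X ∨ x⁻¹ ∈ X) ∧ l.prod = h⁻¹ ∧ l.length = k := by
    rintro h k ⟨l, hl, rfl, rfl⟩
    refine ⟨(l.map (·⁻¹)).reverse, fun x hx => ?_, (List.prod_inv_reverse l).symm, by simp⟩
    obtain ⟨y, hy, rfl⟩ := List.mem_map.1 (List.mem_reverse.1 hx)
    rw [inv_inv]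
    exact (hl y hy).symm
  unfold wordLength
  congr 1
  ext k
  exact ⟨fun h => inv_inv g ▸ inv_word g⁻¹ k h, inv_word g k⟩

theorem wordLength_mul_le (hX : Subgroup.closure X = ⊤) (g h : G) :
    wordLength X (g * h) ≤ wordLength X g + wordLength X h := by
  obtain ⟨l, hl, rfl, hl_len⟩ := exists_list_length_eq_wordLength hX g
  obtain ⟨m, hm, rfl, hm_len⟩ := exists_list_length_eq_wordLength hX h
  rw [← hl_len, ← hm_len, ← List.prod_append, ← List.length_append]
  exact wordLength_prod_le_length fun x hx => (List.mem_append.1 hx).elim (hl x) (hm x)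

theorem wordLength_prod_le (hX : Subgroup.closure X = ⊤) {c : ℕ} {l : List G}
    (hl : ∀ x ∈ l, wordLength X x ≤ c) : wordLength X l.prod ≤ c * l.length := by
  induction l with
  | nil => simp
  | cons x l ih =>
    rw [List.forall_mem_cons] at hl
    rw [List.prod_cons, List.length_cons, mul_add_one, add_comm]
    exact (wordLength_mul_le hX _ _).trans (add_le_add hl.1 (ih hl.2))

theorem wordLength_zpow_le (hX : Subgroup.closure X = ⊤) (g : G) (k : ℤ) :
    wordLength X (g ^ k) ≤ wordLength X g * k.natAbs := by
  have pow_le : ∀ m : ℕ, wordLength X (g ^ m) ≤ wordLength X g * m := fun m => by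
    simpa using wordLength_prod_le hX (l := List.replicate m g) (c := wordLength X g)
      fun x hx => by rw [List.eq_of_mem_replicate hx]
  obtain ⟨m, rfl | rfl⟩ := Int.eq_nat_or_neg k <;> simpa using pow_le m

@[simp] theorem wordDist_one_left (X : Set G) (g : G) : wordDist X 1 g = wordLength X g := by
  simp [wordDist]

@[simp] theorem wordDist_self (X : Set G) (g : G) : wordDist X g g = 0 := by
  simp [wordDist]

theorem wordDist_comm (X : Set G) (g h : G) : wordDist X g h = wordDist X h g := by
  rw [wordDist, wordDist, ← wordLength_inv, mul_inv_rev, inv_inv]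

theorem wordDist_triangle (hX : Subgroup.closure X = ⊤) (a b c : G) :
    wordDist X a c ≤ wordDist X a b + wordDist X b c := by
  simpa [wordDist, mul_assoc] using wordLength_mul_le hX (a⁻¹ * b) (b⁻¹ * c)

@[simp] theorem wordDist_mul_left (X : Set G) (g a b : G) :
    wordDist X (g * a) (g * b) = wordDist X a b := by
  simp [wordDist, mul_assoc]

theorem wordLength_conj (X : Set G) (g y : G) :
    wordLength X (MulAut.conj y⁻¹ g) = wordDist X y (g * y) := by
  simp [wordDist, mul_assoc]

theorem finite_ball (hX : Subgroup.closure X = ⊤) (hXfin : X.Finite) (R : ℕ) :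
    (ball X R).Finite := by
  have : Finite ↥(X ∪ X⁻¹) := hXfin.union hXfin.inv
  refine ((List.finite_length_le ↥(X ∪ X⁻¹) R).image fun l => (l.map Subtype.val).prod).subset ?_
  intro g hg
  obtain ⟨l, hl, rfl, hl_len⟩ := exists_list_length_eq_wordLength hX g
  lift l to List ↥(X ∪ X⁻¹) using hl
  exact ⟨l, by simpa using hl_len.trans_le hg, rfl⟩

theorem wordLength_map_le {H : Type*} [Group H] {X : Finset G} {Y : Finset H}
    (hX : IsFiniteGeneratingSet X) (hY : IsFiniteGeneratingSet Y) (φ : G →* H) (g : G) :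
    wordLength (Y : Set H) (φ g) ≤ homComplexity X Y φ * wordLength (X : Set G) g := by
  obtain ⟨l, hl, rfl, hl_len⟩ := exists_list_length_eq_wordLength hX g
  have generator_le : ∀ x ∈ X, wordLength (Y : Set H) (φ x) ≤ homComplexity X Y φ := fun x hx =>
    Finset.le_sup (f := fun x => wordLength (Y : Set H) (φ x)) hx
  have letter_le : ∀ y ∈ l.map φ, wordLength (Y : Set H) y ≤ homComplexity X Y φ := by
    simp only [List.mem_map, forall_exists_index, and_imp, forall_apply_eq_imp_iff₂]
    intro x hx
    rcases hl x hx with hx | hx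
    · exact generator_le x hx
    · simpa using generator_le x⁻¹ hx
  rw [← hl_len, map_list_prod]
  simpa using wordLength_prod_le hY letter_le

end WordLength

section Geodesic

variable {G : Type*} [Group G] {X : Set G} {a b : G} {L : ℕ} {p : ℕ → G}

theorem IsGeodesic.wordDist_left (hp : IsGeodesic X a b L p) {i : ℕ} (hi : i ≤ L) :
    wordDist X a (p i) = i := by
  simpa [hp.1] using hp.2.2 0 i (Nat.zero_le _) hi

theorem IsGeodesic.wordDist_right (hp : IsGeodesic X a b L p) {i : ℕ} (hi : i ≤ L) :
    wordDist X (p i) b = L - i := by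
  simpa [hp.2.1] using hp.2.2 i L hi le_rfl

theorem isGeodesic_of_wordDist_succ_le_one (hX : Subgroup.closure X = ⊤) (h0 : p 0 = a)
    (hL : p L = b) (hstep : ∀ i < L, wordDist X (p i) (p (i + 1)) ≤ 1) (hab : L ≤ wordDist X a b) :
    IsGeodesic X a b L p := by
  have upper : ∀ i j, i ≤ j → j ≤ L → wordDist X (p i) (p j) ≤ j - i := by
    intro i j hij
    induction j, hij using Nat.le_induction with
    | base => simp
    | succ j hij ih =>
      intro hj
      have := hstep j hj
      have := ih (by omega)
      have := wordDist_triangle hX (p i) (p j) (p (j + 1))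
      omega
  refine ⟨h0, hL, fun i j hij hj => (upper i j hij hj).antisymm ?_⟩
  have initial := upper 0 i (Nat.zero_le i) (hij.trans hj)
  have final := upper j L hj le_rfl
  have := wordDist_triangle hX (p 0) (p i) (p L)
  have := wordDist_triangle hX (p i) (p j) (p L)
  rw [h0, hL] at *
  omega

theorem exists_isGeodesic (hX : Subgroup.closure X = ⊤) (a b : G) :
    ∃ p : ℕ → G, IsGeodesic X a b (wordDist X a b) p := by
  obtain ⟨l, hl, hl_prod, hl_len⟩ := exists_list_length_eq_wordLength hX (a⁻¹ * b)
  rw [wordDist, ← hl_len]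
  refine ⟨fun i => a * (l.take i).prod, isGeodesic_of_wordDist_succ_le_one hX (by simp)
    (by simp [hl_prod]) (fun i hi => ?_) hl_len.le⟩
  rw [wordDist_mul_left, List.prod_take_succ l i hi, wordDist, inv_mul_cancel_left]
  exact wordLength_le_one (hl _ (List.getElem_mem hi))

theorem IsGeodesic.wordDist_add_wordDist_le (hX : Subgroup.closure X = ⊤)
    (hp : IsGeodesic X a b L p) {i δ : ℕ} (hi : i ≤ L) {u : G} (hu : wordDist X u (p i) ≤ δ) :
    wordDist X a u + wordDist X u b ≤ L + 2 * δ := by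
  have := hp.wordDist_left hi
  have := hp.wordDist_right hi
  have := wordDist_triangle hX a (p i) u
  have := wordDist_triangle hX u (p i) b
  rw [wordDist_comm X (p i) u] at *
  omega

theorem IsGeodesic.wordDist_add_wordDist_le_two_mul (hX : Subgroup.closure X = ⊤)
    (hp : IsGeodesic X a b L p) (w : G) {i : ℕ} (hi : i ≤ L) :
    wordDist X w a + wordDist X w b ≤ 2 * wordDist X w (p i) + L := by
  have := hp.wordDist_left hi
  have := hp.wordDist_right hi
  have := wordDist_triangle hX w (p i) a
  have := wordDist_triangle hX w (p i) b
  rw [wordDist_comm X (p i) a] at *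
  omega

end Geodesic

section FourPoint

variable {G : Type*} [Group G] {X : Set G}

/-- Gromov's four-point condition for the word metric, in the form which says that of the three
sums of opposite distances between four points, the largest exceeds the second largest by at
most `D`. -/
def IsFourPointHyperbolic (X : Set G) (D : ℕ) : Prop :=
  ∀ x y z w : G, wordDist X x z + wordDist X y w ≤
    max (wordDist X x y + wordDist X z w) (wordDist X y z + wordDist X x w) + D

theorem exists_adjacent_of_forall_or {P Q : ℕ → Prop} {L : ℕ} (hP : P 0) (hQ : Q L)
    (hPQ : ∀ i ≤ L, P i ∨ Q i) : ∃ i j, i ≤ j ∧ j ≤ i + 1 ∧ j ≤ L ∧ P i ∧ Q j := by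
  induction L with
  | zero => exact ⟨0, 0, by omega, by omega, le_rfl, hP, hQ⟩
  | succ L ih =>
    rcases hPQ L (Nat.le_succ L) with hPL | hQL
    · exact ⟨L, L + 1, by omega, le_rfl, le_rfl, hPL, hQ⟩
    · obtain ⟨i, j, hij, hji, hjL, h⟩ := ih hQL fun i hi => hPQ i (hi.trans (Nat.le_succ L))
      exact ⟨i, j, hij, hji, hjL.trans (Nat.le_succ L), h⟩

/-- In terms of Gromov products, the conclusion reads `d(w, p i) ≤ (x | y)_w + 2 * δ + 1`. -/
theorem HasThinTriangles.exists_vertex_le_gromovProduct (hX : Subgroup.closure X = ⊤) {δ : ℕ}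
    (h : HasThinTriangles X δ) (w : G) {x y : G} {L : ℕ} {p : ℕ → G} (hp : IsGeodesic X x y L p) :
    ∃ i ≤ L, 2 * wordDist X w (p i) + L ≤ wordDist X w x + wordDist X w y + 4 * δ + 2 := by
  obtain ⟨q, hq⟩ := exists_isGeodesic hX y w
  obtain ⟨r, hr⟩ := exists_isGeodesic hX x w
  obtain ⟨i, j, hij, hji, hjL, ⟨k, hk, hik⟩, ⟨m, hm, hjm⟩⟩ := exists_adjacent_of_forall_or
    (P := fun i => ∃ k ≤ wordDist X x w, wordDist X (p i) (r k) ≤ δ)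
    (Q := fun i => ∃ k ≤ wordDist X y w, wordDist X (p i) (q k) ≤ δ)
    ⟨0, Nat.zero_le _, by simp [hp.1, hr.1]⟩ ⟨0, Nat.zero_le _, by simp [hp.2.1, hq.1]⟩
    fun i hi => (h x y w _ _ _ p q r hp hq hr i hi).symm
  have near_xw := hr.wordDist_add_wordDist_le hX hk hik
  have near_yw := hq.wordDist_add_wordDist_le hX hm hjm
  rw [hp.wordDist_left (hij.trans hjL)] at near_xw
  rw [wordDist_comm X y (p j), hp.wordDist_right hjL] at near_yw
  have adjacent := hp.2.2 i j hij hjL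
  have := wordDist_triangle hX w (p i) (p j)
  refine ⟨j, hjL, ?_⟩
  simp only [wordDist_comm X _ w] at *
  omega

theorem HasThinTriangles.isFourPointHyperbolic (hX : Subgroup.closure X = ⊤) {δ : ℕ}
    (h : HasThinTriangles X δ) : IsFourPointHyperbolic X (6 * δ + 2) := by
  intro x y z w
  obtain ⟨p, hp⟩ := exists_isGeodesic hX x z
  obtain ⟨q, hq⟩ := exists_isGeodesic hX z y
  obtain ⟨r, hr⟩ := exists_isGeodesic hX x y
  obtain ⟨i, hi, close_to_w⟩ := h.exists_vertex_le_gromovProduct hX w hp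
  rw [wordDist_comm X y w, wordDist_comm X z w, wordDist_comm X x w, wordDist_comm X y z]
  rcases h x z y _ _ _ p q r hp hq hr i hi with ⟨j, hj, hij⟩ | ⟨j, hj, hij⟩
  · have := hq.wordDist_add_wordDist_le_two_mul hX w hj
    have := wordDist_triangle hX w (p i) (q j)
    omega
  · have := hr.wordDist_add_wordDist_le_two_mul hX w hj
    have := wordDist_triangle hX w (p i) (r j)
    omega

variable {D : ℕ} {a b : G}

theorem IsFourPointHyperbolic.wordLength_mul_add_wordDist_le (h : IsFourPointHyperbolic X D)
    (hab : Commute a b) :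
    wordLength X (a * b) + wordDist X a b ≤ max (2 * wordLength X a) (2 * wordLength X b) + D := by
  have key := h 1 a (a * b) b
  rw [wordDist_comm X (a * b) b] at key
  nth_rw 2 [hab.eq] at key
  simp only [wordDist, inv_one, one_mul, inv_mul_cancel_left] at key ⊢
  omega

theorem IsFourPointHyperbolic.two_mul_wordLength_le (h : IsFourPointHyperbolic X D)
    (hab : Commute a b) :
    2 * wordLength X a ≤
      max (wordLength X (a * b) + wordDist X a b) (2 * wordLength X b) + D := by
  have key := h 1 (a * b) a b
  rw [wordDist_comm X (a * b) b, wordDist_comm X (a * b) a] at key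
  nth_rw 1 [hab.eq] at key
  simp only [wordDist, inv_one, one_mul, inv_mul_cancel_left] at key ⊢
  omega

end FourPoint

section StableLength

open Filter Topology

variable {G : Type*} [Group G] {X : Set G} {D : ℕ}

/-- The stable length (stable translation length) of `g`, the limit of `|g ^ n| / n`. The limit
exists by Fekete's lemma if `X` generates `G`; otherwise the value may be meaningless. -/
noncomputable def stableLength (X : Set G) (g : G) : ℝ :=
  limUnder atTop fun n : ℕ => (wordLength X (g ^ n) : ℝ) / n

theorem subadditive_wordLength_pow (hX : Subgroup.closure X = ⊤) (g : G) :
    Subadditive fun n : ℕ => (wordLength X (g ^ n) : ℝ) := by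
  intro m n
  simp only [pow_add]
  exact_mod_cast wordLength_mul_le hX _ _

theorem bddBelow_range_wordLength_pow_div (X : Set G) (g : G) :
    BddBelow (Set.range fun n : ℕ => (wordLength X (g ^ n) : ℝ) / n) :=
  ⟨0, by rintro _ ⟨n, rfl⟩; positivity⟩

theorem tendsto_stableLength (hX : Subgroup.closure X = ⊤) (g : G) :
    Tendsto (fun n : ℕ => (wordLength X (g ^ n) : ℝ) / n) atTop (𝓝 (stableLength X g)) :=
  tendsto_nhds_limUnder
    ⟨_, (subadditive_wordLength_pow hX g).tendsto_lim (bddBelow_range_wordLength_pow_div X g)⟩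

theorem stableLength_nonneg (hX : Subgroup.closure X = ⊤) (g : G) : 0 ≤ stableLength X g :=
  ge_of_tendsto' (tendsto_stableLength hX g) fun n => by positivity

theorem stableLength_le_wordLength (hX : Subgroup.closure X = ⊤) (g : G) :
    stableLength X g ≤ wordLength X g := by
  have hsub := subadditive_wordLength_pow hX g
  have hbdd := bddBelow_range_wordLength_pow_div X g
  rw [tendsto_nhds_unique (tendsto_stableLength hX g) (hsub.tendsto_lim hbdd)]
  simpa using hsub.lim_le_div hbdd one_ne_zero

theorem stableLength_pow (hX : Subgroup.closure X = ⊤) (g : G) (k : ℕ) :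
    stableLength X (g ^ k) = k * stableLength X g := by
  refine tendsto_nhds_unique (tendsto_stableLength hX (g ^ k)) ?_
  rcases Nat.eq_zero_or_pos k with rfl | hk
  · simp
  have hmul : Tendsto (fun n : ℕ => k * n) atTop atTop := tendsto_id.const_mul_atTop' hk
  refine (((tendsto_stableLength hX g).comp hmul).const_mul (k : ℝ)).congr fun n => ?_
  simp only [Function.comp_apply, pow_mul, Nat.cast_mul]
  field_simp

theorem stableLength_conj (hX : Subgroup.closure X = ⊤) (x g : G) :
    stableLength X (MulAut.conj x g) = stableLength X g := by
  have conj_le : ∀ x g : G, stableLength X (MulAut.conj x g) ≤ stableLength X g := by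
    intro x g
    have hlim := (tendsto_stableLength hX g).add
      (tendsto_const_div_atTop_nhds_zero_nat (2 * wordLength X x : ℝ))
    rw [add_zero] at hlim
    refine le_of_tendsto_of_tendsto' (tendsto_stableLength hX _) hlim fun n => ?_
    have length_le : wordLength X (MulAut.conj x g ^ n) ≤
        wordLength X (g ^ n) + 2 * wordLength X x := by
      rw [← map_pow, MulAut.conj_apply]
      have := wordLength_mul_le hX (x * g ^ n) x⁻¹
      have := wordLength_mul_le hX x (g ^ n)
      rw [wordLength_inv] at *
      omega
    rw [← add_div]
    gcongr
    exact_mod_cast length_le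
  refine (conj_le x g).antisymm ?_
  have := conj_le x⁻¹ (MulAut.conj x g)
  rwa [map_inv, MulAut.inv_apply_self] at this

/-- The four-point condition for `1, g, g ^ 2, g ^ (n + 2)` propagates a failure of the inequality
to `|g ^ n| + 2 ≤ |g ^ (n + 1)|` for all `n`, so that the stable length is at least `2`. -/
theorem IsFourPointHyperbolic.wordLength_sq_le (hX : Subgroup.closure X = ⊤)
    (h : IsFourPointHyperbolic X D) {g : G} (hg : stableLength X g ≤ 1) :
    wordLength X (g ^ 2) ≤ wordLength X g + D + 1 := by
  by_contra! hlt
  have step : ∀ n : ℕ, wordLength X (g ^ n) + 2 ≤ wordLength X (g ^ (n + 1)) := by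
    intro n
    induction n with
    | zero =>
      have := wordLength_mul_le hX g g
      rw [← pow_two] at this
      rw [pow_zero, wordLength_one, zero_add, pow_one]
      omega
    | succ n ih =>
      have key := h 1 g (g ^ 2) (g ^ (n + 2))
      have mul_pow_eq : g⁻¹ * g ^ (n + 2) = g ^ (n + 1) := by group
      have sq_mul_pow_eq : (g ^ 2)⁻¹ * g ^ (n + 2) = g ^ n := by group
      have mul_sq_eq : g⁻¹ * g ^ 2 = g := by group
      simp only [wordDist, inv_one, one_mul, mul_pow_eq, sq_mul_pow_eq, mul_sq_eq] at key
      change wordLength X (g ^ (n + 1)) + 2 ≤ wordLength X (g ^ (n + 2))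
      omega
  have two_mul_le : ∀ n : ℕ, 2 * n ≤ wordLength X (g ^ n) := by
    intro n
    induction n with
    | zero => simp
    | succ n ih => have := step n; omega
  have two_le : (2 : ℝ) ≤ stableLength X g := by
    refine ge_of_tendsto (tendsto_stableLength hX g) ?_
    filter_upwards [eventually_gt_atTop 0] with n hn
    rw [le_div_iff₀ (by positivity)]
    exact_mod_cast two_mul_le n
  linarith

theorem IsFourPointHyperbolic.stableLength_mul_add_stableLength_mul_inv_le
    (hX : Subgroup.closure X = ⊤) (h : IsFourPointHyperbolic X D) {a b : G} (hab : Commute a b) :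
    stableLength X (a * b) + stableLength X (a * b⁻¹) ≤
      2 * max (stableLength X a) (stableLength X b) := by
  have upper := (((tendsto_stableLength hX a).max (tendsto_stableLength hX b)).const_mul 2).add
    (tendsto_const_div_atTop_nhds_zero_nat (D : ℝ))
  rw [add_zero] at upper
  refine le_of_tendsto_of_tendsto'
    ((tendsto_stableLength hX (a * b)).add (tendsto_stableLength hX (a * b⁻¹))) upper fun n => ?_
  have dist_eq : wordDist X (a ^ n) (b ^ n) = wordLength X ((a * b⁻¹) ^ n) := by
    rw [wordDist_comm, wordDist, hab.inv_right.mul_pow, inv_pow,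
      (hab.pow_pow n n).inv_right.eq]
  have key := h.wordLength_mul_add_wordDist_le (hab.pow_pow n n)
  rw [← hab.mul_pow, dist_eq, ← mul_max_of_nonneg _ _ (Nat.zero_le 2)] at key
  rw [max_div_div_right (Nat.cast_nonneg n), ← mul_div_assoc, ← add_div, ← add_div]
  refine div_le_div_of_nonneg_right ?_ (Nat.cast_nonneg n)
  exact_mod_cast key

theorem IsFourPointHyperbolic.min_stableLength_le (hX : Subgroup.closure X = ⊤)
    (h : IsFourPointHyperbolic X D) {a b : G} (hab : Commute a b) :
    min (stableLength X (a * b)) (stableLength X (a * b⁻¹)) ≤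
      |stableLength X a - stableLength X b| := by
  have hcomm : Commute (a * b) (a * b⁻¹) :=
    ((Commute.refl a).mul_left hab.symm).mul_right
      (hab.inv_right.mul_left (Commute.refl b).inv_right)
  have mul_eq : a * b * (a * b⁻¹) = a ^ 2 := by
    rw [hcomm.eq, mul_assoc, hab.eq, inv_mul_cancel_left, pow_two]
  have mul_inv_eq : a * b * (a * b⁻¹)⁻¹ = b ^ 2 := by
    rw [mul_inv_rev, inv_inv, ← mul_assoc, mul_assoc a, ← pow_two, (hab.pow_right 2).eq,
      mul_inv_cancel_right]
  have sum_le := h.stableLength_mul_add_stableLength_mul_inv_le hX hab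
  have le_max := h.stableLength_mul_add_stableLength_mul_inv_le hX hcomm
  rw [mul_eq, mul_inv_eq, stableLength_pow hX, stableLength_pow hX] at le_max
  push_cast at le_max
  grind

end StableLength

section Displacement

variable {G : Type*} [Group G] {X : Set G} {D : ℕ}

theorem IsFourPointHyperbolic.wordDist_le_of_wordLength_sq_le (h : IsFourPointHyperbolic X D)
    {a b : G} (hab : Commute a b) {M : ℕ} (ha : wordLength X a ≤ M) (hb : wordLength X b ≤ M)
    (ha_sq : wordLength X (a ^ 2) ≤ wordLength X a + D + 1)
    (hb_sq : wordLength X (b ^ 2) ≤ wordLength X b + D + 1) :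
    wordDist X a b ≤ M + 2 * D + 1 := by
  have hcomm : Commute (a⁻¹ * b) (a * b) :=
    ((Commute.refl a).inv_left.mul_right hab.inv_left).mul_left (hab.symm.mul_right (.refl b))
  have sum_le := h.wordLength_mul_add_wordDist_le hab
  have two_mul_le := h.two_mul_wordLength_le hcomm
  have mul_eq : a⁻¹ * b * (a * b) = b ^ 2 := by
    rw [mul_assoc, ← mul_assoc b, ← hab.eq, mul_assoc, inv_mul_cancel_left, pow_two]
  have dist_eq : wordDist X (a⁻¹ * b) (a * b) = wordLength X (a ^ 2) := by
    rw [wordDist, mul_inv_rev, inv_inv, mul_assoc, ← mul_assoc a, ← pow_two,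
      (hab.pow_left 2).eq, inv_mul_cancel_left]
  rw [mul_eq, dist_eq] at two_mul_le
  change 2 * wordDist X a b ≤ _ at two_mul_le
  omega

/-- If `t` is a longest element of a commuting family of small stable length, then the geodesics
from `1` to `s`, to `s⁻¹` and to `t` fellow-travel for a while, for each long `s` in the family;
moving the base point `1` along them to `y` decreases the displacement of `s`. -/
theorem IsFourPointHyperbolic.wordLength_conj_lt (hX : Subgroup.closure X = ⊤)
    (h : IsFourPointHyperbolic X D) {s t y : G} {M : ℕ} (hM : 10 * D + 5 < M)
    (hs : wordLength X s ≤ M) (hs_sq : wordLength X (s ^ 2) ≤ wordLength X s + D + 1)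
    (ht : wordLength X t = M) (hst : wordDist X s t ≤ M + 2 * D + 1)
    (hy : wordLength X y = 2 * D + 1) (hyt : wordDist X y t = M - (2 * D + 1)) :
    wordLength X (MulAut.conj y⁻¹ s) < M := by
  rw [wordLength_conj]
  have dist_one_y : wordDist X y 1 = 2 * D + 1 := by rw [wordDist_comm, wordDist_one_left, hy]
  have dist_sy_s : wordDist X (s * y) s = 2 * D + 1 := by simp [wordDist, hy]
  have dist_one_sy : wordDist X 1 (s * y) = wordDist X y s⁻¹ := by
    rw [← wordDist_mul_left X s y, mul_inv_cancel, wordDist_comm]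
  have dist_inv_s : wordDist X s⁻¹ s = wordLength X (s ^ 2) := by simp [wordDist, pow_two]
  rcases lt_or_ge (wordLength X s + 2 * (2 * D + 1)) M with s_short | s_long
  · have := wordDist_triangle hX y 1 (s * y)
    have := wordDist_triangle hX 1 s (s * y)
    rw [wordDist_comm X s (s * y), wordDist_one_left X s] at *
    omega
  have dist_y_s : wordDist X y s + D + 1 ≤ wordLength X s := by
    have := h y 1 s t
    simp only [wordDist_one_left] at this
    omega
  have dist_y_inv_s : wordDist X y s⁻¹ + 1 ≤ wordLength X s := by
    have := h y 1 s⁻¹ s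
    simp only [wordDist_one_left, wordLength_inv] at this
    omega
  have := h y 1 (s * y) s
  rw [wordDist_one_left X s] at this
  omega

theorem IsFourPointHyperbolic.exists_conj_wordLength_lt (hX : Subgroup.closure X = ⊤)
    (h : IsFourPointHyperbolic X D) {ι : Type*} {s : ι → G} (hcomm : ∀ i j, Commute (s i) (s j))
    (hstable : ∀ i, stableLength X (s i) ≤ 1) {M : ℕ} (hM : 10 * D + 5 < M)
    (hs : ∀ i, wordLength X (s i) ≤ M) : ∃ x, ∀ i, wordLength X (MulAut.conj x (s i)) < M := by
  by_cases! hlt : ∀ i, wordLength X (s i) < M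
  · exact ⟨1, by simpa using hlt⟩
  obtain ⟨j, hj⟩ := hlt
  replace hj : wordLength X (s j) = M := (hs j).antisymm hj
  obtain ⟨p, hp⟩ := exists_isGeodesic hX 1 (s j)
  rw [wordDist_one_left, hj] at hp
  have hr : 2 * D + 1 ≤ M := by omega
  have hsq i := h.wordLength_sq_le hX (hstable i)
  refine ⟨(p (2 * D + 1))⁻¹, fun i => h.wordLength_conj_lt hX hM (hs i) (hsq i) hj ?_ ?_
    (hp.wordDist_right hr)⟩
  · exact h.wordDist_le_of_wordLength_sq_le (hcomm i j) (hs i) (hs j) (hsq i) (hsq j)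
  · rw [← wordDist_one_left, hp.wordDist_left hr]

theorem IsFourPointHyperbolic.exists_conj_mem_ball (hX : Subgroup.closure X = ⊤)
    (h : IsFourPointHyperbolic X D) {ι : Type*} {s : ι → G} (hcomm : ∀ i j, Commute (s i) (s j))
    (hstable : ∀ i, stableLength X (s i) ≤ 1) {M : ℕ} (hs : ∀ i, wordLength X (s i) ≤ M) :
    ∃ x, ∀ i, MulAut.conj x (s i) ∈ ball X (10 * D + 5) := by
  induction M generalizing s with
  | zero => exact ⟨1, fun i => by simpa [ball] using (hs i).trans (Nat.zero_le _)⟩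
  | succ M ih =>
    rcases le_or_gt (M + 1) (10 * D + 5) with hM | hM
    · exact ⟨1, fun i => by simpa [ball] using (hs i).trans hM⟩
    obtain ⟨y, hy⟩ := h.exists_conj_wordLength_lt hX hcomm hstable hM hs
    obtain ⟨x, hx⟩ := ih (fun i j => (hcomm i j).map (MulAut.conj y))
      (fun i => (stableLength_conj hX y (s i)).trans_le (hstable i))
      fun i => Nat.lt_succ_iff.1 (hy i)
    exact ⟨x * y, fun i => by simpa only [map_mul, MulAut.mul_apply] using hx i⟩

end Displacement

section AbelianGrowth

variable {G : Type*} [Group G]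

/-- Abelian subgroups have linear growth, uniformly: each of them has at most `N * (T + 1)` elements
in the ball of radius `T`. The balls should be finite, as `Set.ncard` is `0` on infinite sets. -/
def HasLinearAbelianGrowth (X : Set G) (N : ℕ) : Prop :=
  ∀ (A : Subgroup G) (T : ℕ), IsMulCommutative A → ((A : Set G) ∩ ball X T).ncard ≤ N * (T + 1)

variable {X : Set G} {D : ℕ} {A : Subgroup G} [IsMulCommutative A]

theorem IsFourPointHyperbolic.card_le_ncard_ball (hX : Subgroup.closure X = ⊤) (hXfin : X.Finite)
    (h : IsFourPointHyperbolic X D) {S : Finset G} (hSA : ∀ a ∈ S, a ∈ A)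
    (hstable : ∀ a ∈ S, stableLength X a ≤ 1) : S.card ≤ (ball X (10 * D + 5)).ncard := by
  obtain ⟨x, hx⟩ := h.exists_conj_mem_ball hX (s := ((↑) : S → G))
    (fun a b => setLike_mul_comm (hSA a a.2) (hSA b b.2)) (fun a => hstable a a.2)
    (M := S.sup (wordLength X)) fun a => Finset.le_sup a.2
  rw [← Set.ncard_coe_finset]
  exact Set.ncard_le_ncard_of_injOn (MulAut.conj x) (fun a ha => hx ⟨a, ha⟩)
    (MulAut.conj x).injective.injOn (finite_ball hX hXfin _)

theorem IsFourPointHyperbolic.card_le_two_mul_ncard_ball (hX : Subgroup.closure X = ⊤)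
    (hXfin : X.Finite) (h : IsFourPointHyperbolic X D) {S : Finset G} (hSA : ∀ a ∈ S, a ∈ A)
    (hclose : ∀ a ∈ S, ∀ b ∈ S, |stableLength X a - stableLength X b| ≤ 1) :
    S.card ≤ 2 * (ball X (10 * D + 5)).ncard := by
  classical
  rcases S.eq_empty_or_nonempty with rfl | ⟨b, hb⟩
  · simp
  have card_le : ∀ c ∈ A, (S.filter fun a => stableLength X (a * c) ≤ 1).card ≤
      (ball X (10 * D + 5)).ncard := by
    intro c hc
    rw [← Finset.card_image_of_injective _ (mul_left_injective c)]
    apply h.card_le_ncard_ball (A := A) hX hXfin <;>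
      simp only [Finset.forall_mem_image, Finset.mem_filter]
    · exact fun a ha => mul_mem (hSA a ha.1) hc
    · exact fun a ha => ha.2
  have cover : S ⊆ S.filter (fun a => stableLength X (a * b) ≤ 1) ∪
      S.filter fun a => stableLength X (a * b⁻¹) ≤ 1 := by
    intro a ha
    rw [← Finset.filter_or, Finset.mem_filter]
    exact ⟨ha, min_le_iff.1 ((h.min_stableLength_le hX
      (setLike_mul_comm (hSA a ha) (hSA b hb))).trans (hclose a ha b hb))⟩
  have := card_le b (hSA b hb)
  have := card_le b⁻¹ (inv_mem (hSA b hb))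
  have := (Finset.card_le_card cover).trans (Finset.card_union_le _ _)
  omega

theorem IsFourPointHyperbolic.hasLinearAbelianGrowth (hX : Subgroup.closure X = ⊤)
    (hXfin : X.Finite) (h : IsFourPointHyperbolic X D) :
    HasLinearAbelianGrowth X (2 * (ball X (10 * D + 5)).ncard) := by
  classical
  intro A T _
  have hfin : ((A : Set G) ∩ ball X T).Finite := (finite_ball hX hXfin T).inter_of_right _
  rw [Set.ncard_eq_toFinset_card _ hfin, ← Finset.card_range (T + 1)]
  refine Finset.card_le_mul_card_image_of_maps_to (f := fun a => ⌊stableLength X a⌋₊)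
    (fun a ha => ?_) _ fun m _ => h.card_le_two_mul_ncard_ball (A := A) hX hXfin ?_ ?_
  · have ha_le : wordLength X a ≤ T := ((Set.Finite.mem_toFinset hfin).1 ha).2
    rw [Finset.mem_range, Nat.lt_succ_iff]
    exact Nat.floor_le_of_le ((stableLength_le_wordLength hX a).trans (by exact_mod_cast ha_le))
  · intro a ha
    exact ((Set.Finite.mem_toFinset hfin).1 (Finset.mem_filter.1 ha).1).1
  · intro a ha b hb
    have floor_eq : ⌊stableLength X a⌋₊ = ⌊stableLength X b⌋₊ :=
      (Finset.mem_filter.1 ha).2.trans (Finset.mem_filter.1 hb).2.symm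
    have := Nat.floor_le (stableLength_nonneg hX a)
    have := Nat.floor_le (stableLength_nonneg hX b)
    have := Nat.lt_floor_add_one (stableLength X a)
    have := Nat.lt_floor_add_one (stableLength X b)
    rw [floor_eq] at *
    rw [abs_le]
    constructor <;> linarith

theorem HasLinearAbelianGrowth.of_isFiniteGeneratingSet {Y Z : Finset G}
    (hY : IsFiniteGeneratingSet Y) (hZ : IsFiniteGeneratingSet Z) {N : ℕ}
    (h : HasLinearAbelianGrowth (Z : Set G) N) :
    HasLinearAbelianGrowth (Y : Set G) (N * (homComplexity Y Z (MonoidHom.id G) + 1)) := by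
  intro A T hA
  set c := homComplexity Y Z (MonoidHom.id G)
  have ball_subset : ball (Y : Set G) T ⊆ ball (Z : Set G) (c * T) := fun g hg =>
    (wordLength_map_le hY hZ (MonoidHom.id G) g).trans (Nat.mul_le_mul_left c hg)
  calc ((A : Set G) ∩ ball (Y : Set G) T).ncard
      ≤ ((A : Set G) ∩ ball (Z : Set G) (c * T)).ncard :=
        Set.ncard_le_ncard (Set.inter_subset_inter_right _ ball_subset)
          ((finite_ball hZ Z.finite_toSet _).inter_of_right _)
    _ ≤ N * (c * T + 1) := h A (c * T) hA
    _ ≤ N * (c + 1) * (T + 1) := by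
        rw [mul_assoc]
        gcongr
        nlinarith

theorem IsHyperbolicGroup.exists_hasLinearAbelianGrowth (hG : IsHyperbolicGroup G) {Y : Finset G}
    (hY : IsFiniteGeneratingSet Y) : ∃ N, HasLinearAbelianGrowth (Y : Set G) N := by
  obtain ⟨Z, hZ, δ, hδ⟩ := hG
  exact ⟨_, ((hδ.isFourPointHyperbolic hZ).hasLinearAbelianGrowth hZ
    Z.finite_toSet).of_isFiniteGeneratingSet hY hZ⟩

end AbelianGrowth

section DiscriminatingComplexity

variable {G H : Type*} [Group G] [Group H]

theorem IsFullyResidually.exists_homComplexity_eq (hG : IsFullyResidually G H) {X : Finset G}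
    (hX : IsFiniteGeneratingSet X) (Y : Finset H) (R : ℕ) :
    ∃ φ : G →* H, Discriminates φ (ball (X : Set G) R \ {1}) ∧
      homComplexity X Y φ = discriminatingComplexity X Y R := by
  obtain ⟨φ, hφ⟩ := hG (ball (X : Set G) R \ {1}) (finite_ball hX X.finite_toSet R).sdiff (by simp)
  exact Nat.sInf_mem (s := {k | ∃ φ : G →* H, Discriminates φ (ball (X : Set G) R \ {1}) ∧
    homComplexity X Y φ = k}) ⟨_, φ, hφ, rfl⟩

theorem Discriminates.eq_of_map_eq {X : Set G} {R : ℕ} {φ : G →* H}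
    (hφ : Discriminates φ (ball X R \ {1})) {g h : G} (hgh : wordLength X (g / h) ≤ R)
    (heq : φ g = φ h) : g = h := by
  by_contra hne
  exact hφ (g / h) ⟨hgh, fun h1 => hne (div_eq_one.1 h1)⟩ (by rw [map_div, heq, div_self'])

theorem exists_wordLength_le_of_natAbs_le {X : Set G} (hX : Subgroup.closure X = ⊤) {ι : Type*}
    [Finite ι] (f : Multiplicative (ι → ℤ) →* G) :
    ∃ L : ℕ, ∀ (R : ℕ) (v : ι → ℤ), (∀ i, (v i).natAbs ≤ R) →
      wordLength X (f (.ofAdd v)) ≤ L * R := by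
  classical
  cases nonempty_fintype ι
  let len (v : ι → ℤ) : ℕ := wordLength X (f (.ofAdd v))
  have len_add (v w) : len (v + w) ≤ len v + len w := by
    simpa only [len, ofAdd_add, map_mul] using wordLength_mul_le hX _ _
  refine ⟨∑ i, len (Pi.single i 1), fun R v hv => ?_⟩
  calc len v = len (∑ i, v i • Pi.single i 1) := by rw [← pi_eq_sum_univ' v]
    _ ≤ ∑ i, len (v i • Pi.single i 1) :=
        Finset.le_sum_of_subadditive len (by simp [len]) len_add _ _
    _ ≤ ∑ i, len (Pi.single i 1) * (v i).natAbs := by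
        gcongr with i
        simpa only [len, ofAdd_zsmul, map_zpow] using wordLength_zpow_le hX _ _
    _ ≤ (∑ i, len (Pi.single i 1)) * R := by
        rw [Finset.sum_mul]
        gcongr with i
        exact hv i

theorem Discriminates.succ_pow_card_le {X : Finset G} {Y : Finset H} (hX : IsFiniteGeneratingSet X)
    (hY : IsFiniteGeneratingSet Y) {N : ℕ} (hN : HasLinearAbelianGrowth (Y : Set H) N)
    {ι : Type*} [Fintype ι] {f : Multiplicative (ι → ℤ) →* G} (hf : Function.Injective f)
    {L R : ℕ} (hL : ∀ v : ι → ℤ, (∀ i, (v i).natAbs ≤ R) →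
      wordLength (X : Set G) (f (.ofAdd v)) ≤ L * R)
    {φ : G →* H} (hφ : Discriminates φ (ball (X : Set G) (L * R) \ {1})) :
    (R + 1) ^ Fintype.card ι ≤ N * (homComplexity X Y φ * (L * R) + 1) := by
  classical
  let cube : Finset (ι → ℤ) := Finset.Icc 0 fun _ => R
  have cube_bounds {v} (hv : v ∈ cube) (i) : 0 ≤ v i ∧ v i ≤ R :=
    ⟨(Finset.mem_Icc.1 hv).1 i, (Finset.mem_Icc.1 hv).2 i⟩
  have card_cube : cube.card = (R + 1) ^ Fintype.card ι := by
    simp [cube, Pi.card_Icc]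
  rw [← card_cube, ← Set.ncard_coe_finset]
  have maps_to : Set.MapsTo (fun v => φ (f (.ofAdd v))) cube
      ((φ.comp f).range ∩ ball Y (homComplexity X Y φ * (L * R))) := by
    intro v hv
    refine ⟨⟨.ofAdd v, rfl⟩,
      (wordLength_map_le hX hY φ _).trans (Nat.mul_le_mul_left _ (hL v fun i => ?_))⟩
    have := cube_bounds hv i
    omega
  have inj_on : Set.InjOn (fun v => φ (f (.ofAdd v))) cube := by
    intro v hv w hw hvw
    refine Multiplicative.ofAdd.injective (hf (hφ.eq_of_map_eq ?_ hvw))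
    rw [← map_div, ← ofAdd_sub]
    refine hL _ fun i => ?_
    have := cube_bounds hv i
    have := cube_bounds hw i
    rw [Pi.sub_apply]
    omega
  exact (Set.ncard_le_ncard_of_injOn _ maps_to inj_on
    ((finite_ball hY Y.finite_toSet _).inter_of_right _)).trans (hN _ _ inferInstance)

theorem pow_le_of_succ_pow_succ_le {n N C L R : ℕ}
    (h : (R + 1) ^ (n + 1) ≤ N * (C * (L * R) + 1)) :
    R ^ n ≤ (N + 1) * (L + 1) * C + (N + 1) * (L + 1) := by
  refine (Nat.pow_le_pow_left R.le_succ n).trans (Nat.le_of_mul_le_mul_right ?_ R.succ_pos)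
  calc (R + 1) ^ n * (R + 1) ≤ N * (C * (L * R) + 1) := by rwa [← pow_succ]
    _ ≤ (N + 1) * ((C + 1) * ((L + 1) * (R + 1))) := by
        gcongr
        · exact N.le_succ
        · nlinarith [Nat.zero_le (C * L), Nat.zero_le (C * R)]
    _ = ((N + 1) * (L + 1) * C + (N + 1) * (L + 1)) * (R + 1) := by ring

end DiscriminatingComplexity

end LimitGroups

theorem mainTheorem6_general {Γ : Type*} [Group Γ] (hΓ : LimitGroups.IsHyperbolicGroup Γ)
    {G : Type*} [Group G] (hG : LimitGroups.IsFullyResidually G Γ)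
    (n : ℕ) (hA : LimitGroups.HasFreeAbelianSubgroupOfRank G (n + 1))
    (X : Finset G) (hX : LimitGroups.IsFiniteGeneratingSet X)
    (Y : Finset Γ) (hY : LimitGroups.IsFiniteGeneratingSet Y) :
    ∃ p : Polynomial ℕ, p.degree = (n : WithBot ℕ) ∧
      LimitGroups.AsymptoticallyDominatedBy (fun R => p.eval R)
        (LimitGroups.discriminatingComplexity X Y) := by
  obtain ⟨N, hN⟩ := hΓ.exists_hasLinearAbelianGrowth hY
  obtain ⟨A, ⟨e⟩⟩ := hA
  let f : Multiplicative (Fin (n + 1) → ℤ) →* G := A.subtype.comp e.symm.toMonoidHom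
  have hf : Function.Injective f := A.subtype_injective.comp e.symm.injective
  obtain ⟨L, hL⟩ := LimitGroups.exists_wordLength_le_of_natAbs_le hX f
  let K := (N + 1) * (L + 1)
  refine ⟨Polynomial.X ^ n, Polynomial.degree_X_pow n, K, fun R => ?_⟩
  obtain ⟨φ, hφ, hφC⟩ := hG.exists_homComplexity_eq hX Y (K * R)
  have hLK : L * R ≤ K * R := Nat.mul_le_mul_right R (by simp only [K]; nlinarith)
  have hφ_small : LimitGroups.Discriminates φ (LimitGroups.ball (X : Set G) (L * R) \ {1}) :=
    fun g hg => hφ g ⟨hg.1.trans hLK, hg.2⟩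
  have count := hφ_small.succ_pow_card_le hX hY hN hf (hL R)
  rw [Fintype.card_fin, hφC] at count
  simpa using LimitGroups.pow_le_of_succ_pow_succ_le count

theorem mainTheorem6 {Γ : Type*} [Group Γ] (hΓ : LimitGroups.IsHyperbolicGroup Γ)
    (hΓtf : LimitGroups.IsTorsionFreeGroup Γ)
    {G : Type*} [Group G] (hG : LimitGroups.IsLimitGroup Γ G)
    (n : ℕ) (hA : LimitGroups.HasFreeAbelianSubgroupOfRank G (n + 1))
    (X : Finset G) (hX : LimitGroups.IsFiniteGeneratingSet X)
    (Y : Finset Γ) (hY : LimitGroups.IsFiniteGeneratingSet Y) :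
    ∃ p : Polynomial ℕ, p.degree = (n : WithBot ℕ) ∧
      LimitGroups.AsymptoticallyDominatedBy (fun R => p.eval R)
        (LimitGroups.discriminatingComplexity X Y) :=
  mainTheorem6_general hΓ hG.2 n hA X hX Y hY
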